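/- Let $d\ge 0$, let $\mu$ be a probability distribution on $\mathbb{R}^{d\times d}$ with compact support $\mathcal M=\operatorname{supp}\mu$, and let $\|\cdot\|$ be any norm on $\mathbb{R}^d$. A proper cone in $\mathbb{R}^d$ is a closed convex set $K$, stable under multiplication by nonnegative scalars, with nonempty interior and with $K\cap(-K)=\{0\}$. Assume that (a) there is a proper cone $K\subset\mathbb{R}^d$ with $MK\subset K$ for every $M\in\mathcal M$; and (b) the singular part $\mu_s$ of $\mu$ with respect to Lebesgue measure on $\mathbb{R}^{d\times d}$ is of the form $\mu_s=\sum_{i=1}^N p_i\delta_{M_i}$ with $N\ge 0$, $p_i>0$ and $M_i\in\mathbb{R}^{d\times d}$. Let $A_0,A_1,\dots$ be independent random matrices, each with distribution $\mu$, and let $x(k;x_0)$ be the solution of $x(k+1)=A_kx(k)$, $x(0)=x_0$. The deterministic switched system $\Sigma_{\mathcal M}$ is called absolutely asymptotically stable if, for every sequence $(B_k)_{k\ge 0}$ in $\mathcal M$ and every initial state, the solution of $x(k+1)=B_kx(k)$ tends to $0$ as $k\to\infty$. Then the following three conditions are equivalent. 1. $\Sigma_{\mathcal M}$ is absolutely asymptotically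 stable. 2. There is a single $\gamma\in[0,1)$ such that for every integer $p\ge1$ the stochastic system is exponentially stable in $p$th mean with decay rate at most $\gamma$: there are $M,\beta>0$ (which may depend on $p$) with $e^{-\beta/p}\le\gamma$ and $E[\|x(k;x_0)\|^p]\le M e^{-\beta k}\|x_0\|^p$ for all $x_0\in\mathbb{R}^d$ and $k\ge0$. 3. There is a single $\gamma\in[0,1)$ such that for every integer $p\ge1$ and every $x_0\in\mathbb{R}^d$, $E[\|x(k;x_0)\|^p]^{1/p}=O(\gamma^k)$ as $k\to\infty$ (the implied constant may depend on $p$ and $x_0$). -/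

import Mathlib

open MeasureTheory ProbabilityTheory Filter Asymptotics
open scoped Topology ENNReal

namespace SwitchedSystem

/-- The space `ℝ^{d×d}` of real square matrices. -/
abbrev Mat (d : ℕ) : Type := Matrix (Fin d) (Fin d) ℝ

/-- The (Borel) product σ-algebra on `ℝ^{d×d}`. -/
instance instMeasurableSpaceMat (d : ℕ) : MeasurableSpace (Matrix (Fin d) (Fin d) ℝ) :=
  inferInstanceAs (MeasurableSpace (Fin d → Fin d → ℝ))

instance instBorelSpaceMat (d : ℕ) : BorelSpace (Matrix (Fin d) (Fin d) ℝ) :=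
  inferInstanceAs (BorelSpace (Fin d → Fin d → ℝ))

instance instSecondCountableTopologyMat (d : ℕ) :
    SecondCountableTopology (Matrix (Fin d) (Fin d) ℝ) :=
  inferInstanceAs (SecondCountableTopology (Fin d → Fin d → ℝ))

/-- Lebesgue measure on `ℝ^{d×d}`. -/
noncomputable def lebesgue (d : ℕ) : Measure (Mat d) :=
  Measure.map (Matrix.of : (Fin d → Fin d → ℝ) → Mat d) volume

instance instSigmaFiniteLebesgue (d : ℕ) : SigmaFinite (lebesgue d) := by
  have h : lebesgue d = (volume : Measure (Fin d → Fin d → ℝ)) := Measure.map_id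
  have i : SigmaFinite (volume : Measure (Fin d → Fin d → ℝ)) := inferInstance
  exact h ▸ i

/-- A proper cone in `ℝ^d`: a subset closed under multiplication by nonnegative scalars which is
closed, convex, solid (nonempty interior) and pointed (contains no line). -/
structure IsProperCone {d : ℕ} (K : Set (Fin d → ℝ)) : Prop where
  smul_mem : ∀ c : ℝ, 0 ≤ c → ∀ x ∈ K, c • x ∈ K
  isClosed : IsClosed K
  convex : Convex ℝ K
  solid : (interior K).Nonempty
  pointed : ∀ x, x ∈ K → -x ∈ K → x = 0

/-- The set of matrices `ℳ` leaves the set `K` invariant: `M K ⊆ K` for every `M ∈ ℳ`. -/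
def LeavesInvariant {d : ℕ} (ℳ : Set (Mat d)) (K : Set (Fin d → ℝ)) : Prop :=
  ∀ M ∈ ℳ, ∀ x ∈ K, M.mulVec x ∈ K

/-- The standing assumption on `μ`: the support of `μ` leaves a proper cone invariant, and the
singular part of `μ` (with respect to Lebesgue measure) is a finite (possibly empty) combination
`∑ pᵢ δ_{Mᵢ}` of point measures with `pᵢ > 0`. -/
structure ConeAndAtomicSingularPart {d : ℕ} (μ : Measure (Mat d)) : Prop where
  invariant_cone : ∃ K : Set (Fin d → ℝ), IsProperCone K ∧ LeavesInvariant μ.support K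
  singular_atomic : ∃ (N : ℕ) (p : Fin N → ℝ) (M : Fin N → Mat d), (∀ i, 0 < p i) ∧
    μ.singularPart (lebesgue d) = ∑ i, ENNReal.ofReal (p i) • Measure.dirac (M i)

/-- The solution of `x(k+1) = A_k x(k)`, `x(0) = x₀`. -/
def trajectory {d : ℕ} (A : ℕ → Mat d) (x₀ : Fin d → ℝ) : ℕ → (Fin d → ℝ)
  | 0 => x₀
  | k + 1 => (A k).mulVec (trajectory A x₀ k)

/-- The deterministic switched system `x(k+1) = A_k x(k)`, `A_k ∈ ℳ`, is absolutely asymptotically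
stable: `x(k) → 0` for every switching sequence in `ℳ` and every initial state. -/
def AbsolutelyAsymptoticallyStable {d : ℕ} (ℳ : Set (Mat d)) : Prop :=
  ∀ A : ℕ → Mat d, (∀ k, A k ∈ ℳ) → ∀ x₀ : Fin d → ℝ,
    Tendsto (trajectory A x₀) atTop (𝓝 0)

/-- `A_0, A_1, …` are independent random matrices, each with law `μ`. -/
structure FollowIndependently {d : ℕ} {Ω : Type*} [MeasurableSpace Ω]
    (A : ℕ → Ω → Mat d) (μ : Measure (Mat d)) (P : Measure Ω) : Prop where
  hasLaw : ∀ k, HasLaw (A k) μ P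
  indep : iIndepFun A P

/-- `E[‖x(k; x₀)‖^p]` for the stochastic system `x(k+1) = A_k x(k)` and the norm `nrm`. -/
noncomputable def meanPow {d : ℕ} {Ω : Type*} [MeasurableSpace Ω] (P : Measure Ω)
    (nrm : Seminorm ℝ (Fin d → ℝ)) (A : ℕ → Ω → Mat d) (p : ℕ) (x₀ : Fin d → ℝ) (k : ℕ) : ℝ :=
  ∫ ω, nrm (trajectory (fun j => A j ω) x₀ k) ^ p ∂P

/-- Exponential stability in `p`th mean, `E[‖x(k; x₀)‖^p] ≤ M e^{-βk} ‖x₀‖^p` with `M, β > 0`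
uniform in `x₀` and `k`, with decay rate at most `γ`, i.e. `(e^{-β})^{1/p} ≤ γ`. -/
def MeanStableWithRate {d : ℕ} {Ω : Type*} [MeasurableSpace Ω] (P : Measure Ω)
    (nrm : Seminorm ℝ (Fin d → ℝ)) (A : ℕ → Ω → Mat d) (p : ℕ) (γ : ℝ) : Prop :=
  ∃ M β : ℝ, 0 < M ∧ 0 < β ∧ Real.exp (-β) ^ (1 / (p : ℝ)) ≤ γ ∧
    ∀ (x₀ : Fin d → ℝ) (k : ℕ),
      meanPow P nrm A p x₀ k ≤ M * Real.exp (-β * k) * nrm x₀ ^ p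

end SwitchedSystem

namespace SwitchedSystem

/-! ### Comparison of seminorms in finite dimension -/

section FiniteDimensional

variable {E : Type*} [NormedAddCommGroup E] [NormedSpace ℝ E] [FiniteDimensional ℝ E]

/-! Almost surely every `A k` lies in the support. If the deterministic system is stable,
compactness makes its decay uniformly exponential (`exists_exponential_bound`), and integrating this
bound gives every $p$th mean with one rate; taking $p$th roots gives the big-O form.

The converse is the substance. Order matrices by "the difference maps $K$ into $K$". Hypothesis (b)
makes dense in the support those $M$ for which, for each $q<1$, a random matrix dominates $qM$ with
positive probability (`support_subset_closure_dominatedSupport`). For finitely many such $M$ this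
probability is at least some $\delta>0$. By independence, a length-$k$ product of them, scaled by
$q^k$, is dominated by the random product with probability at least $\delta^k$. Normality of the
cone and Markov's inequality then bound its growth rate by a multiple, $q^{-1}\delta^{-1/p}$, of the
$p$th mean rate. As $p\to\infty$ and $q\to1$ the loss disappears, so finite subfamilies grow no
faster than $\eta^k$ for some $\eta<1$ that does not depend on the subfamily
(`exists_norm_wordProd_le`).

To pass from finite subfamilies to all dominated matrices, `exists_norm_apply_le` builds one norm
that the whole family, divided by $\eta$, expands by at most $1+\delta$, with $\delta>0$ now
arbitrary. A small $\delta$ makes it a strict contraction norm, and contraction survives passage to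
the closure. -/

theorem seminorm_continuous (p : Seminorm ℝ E) : Continuous p :=
  continuousOn_univ.1 (p.convexOn.continuousOn isOpen_univ)

/-- On a finite-dimensional space every seminorm is dominated by every norm. -/
theorem exists_seminorm_le_mul (p q : Seminorm ℝ E) (hq : ∀ x, q x = 0 → x = 0) :
    ∃ C : ℝ, 0 < C ∧ ∀ x, p x ≤ C * q x := by
  have key : ∃ c : ℝ, 0 < c ∧ ∀ x, ‖x‖ ≤ c * q x := by
    rcases (Metric.sphere (0 : E) 1).eq_empty_or_nonempty with h | h
    · refine ⟨1, one_pos, fun x => ?_⟩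
      have hx : x = 0 := by
        by_contra hx
        have : ‖x‖⁻¹ • x ∈ Metric.sphere (0 : E) 1 := by
          simp [norm_smul, hx]
        simp [h] at this
      simp [hx]
    · obtain ⟨u, hu, hmin⟩ := (isCompact_sphere (0 : E) 1).exists_isMinOn h
        (seminorm_continuous q).continuousOn
      have hu1 : ‖u‖ = 1 := by simpa using hu
      have hpos : 0 < q u := by
        refine lt_of_le_of_ne (apply_nonneg q u) fun h0 => ?_
        have : u = 0 := hq u h0.symm
        simp [this] at hu1
      refine ⟨(q u)⁻¹, inv_pos.2 hpos, fun x => ?_⟩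
      rcases eq_or_ne x 0 with rfl | hx
      · simp
      have hx' : 0 < ‖x‖ := norm_pos_iff.2 hx
      have h1 : q u ≤ q (‖x‖⁻¹ • x) := hmin (by simp [norm_smul, hx])
      rw [map_smul_eq_mul, norm_inv, norm_norm, ← div_eq_inv_mul, le_div_iff₀ hx'] at h1
      rwa [← div_eq_inv_mul, le_div_iff₀ hpos, mul_comm]
  obtain ⟨c, hc, hcq⟩ := key
  obtain ⟨C, hC, hCp⟩ := p.bound_of_continuous_normedSpace (seminorm_continuous p)
  refine ⟨C * c, by positivity, fun x => (hCp x).trans ?_⟩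
  rw [mul_assoc]
  exact mul_le_mul_of_nonneg_left (hcq x) hC.le

theorem exists_seminorm_le_mul_norm (p : Seminorm ℝ E) :
    ∃ C : ℝ, 0 < C ∧ ∀ x, p x ≤ C * ‖x‖ :=
  p.bound_of_continuous_normedSpace (seminorm_continuous p)

end FiniteDimensional

/-! ### Products of operators along words -/

section Words

variable {ι E : Type*} [AddCommGroup E] [Module ℝ E]

/-- The product of the operators `T i` along a word. -/
noncomputable def wordProd (T : ι → Module.End ℝ E) (w : List ι) : Module.End ℝ E := (w.map T).prod

@[simp] theorem wordProd_nil (T : ι → Module.End ℝ E) (x : E) : wordProd T [] x = x := by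
  simp [wordProd]

theorem wordProd_cons (T : ι → Module.End ℝ E) (i : ι) (w : List ι) (x : E) :
    wordProd T (i :: w) x = T i (wordProd T w x) := by
  simp [wordProd]

theorem wordProd_append (T : ι → Module.End ℝ E) (v w : List ι) (x : E) :
    wordProd T (v ++ w) x = wordProd T v (wordProd T w x) := by
  simp [wordProd]

theorem wordProd_mapQ (T : ι → Module.End ℝ E) (V : Submodule ℝ E)
    (hV : ∀ i, V ≤ V.comap (T i)) (w : List ι) (x : E) :
    wordProd (fun i => V.mapQ V (T i) (hV i)) w (Submodule.Quotient.mk x)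
      = Submodule.Quotient.mk (wordProd T w x) := by
  induction w with
  | nil => simp
  | cons i w ih => simp [wordProd_cons, ih]

end Words

/-! ### Bounded orbits and nearly contracted norms -/

section Normed

variable {ι E : Type*} [NormedAddCommGroup E] [NormedSpace ℝ E]

/-- The vectors with a bounded orbit under the semigroup generated by `T`. -/
def boundedOrbits (T : ι → Module.End ℝ E) : Submodule ℝ E where
  carrier := {x | ∃ C : ℝ, ∀ w : List ι, ‖wordProd T w x‖ ≤ C}
  zero_mem' := ⟨0, fun w => by simp⟩
  add_mem' := by
    rintro x y ⟨C, hC⟩ ⟨D, hD⟩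
    refine ⟨C + D, fun w => ?_⟩
    rw [map_add]
    exact (norm_add_le _ _).trans (add_le_add (hC w) (hD w))
  smul_mem' := by
    rintro c x ⟨C, hC⟩
    refine ⟨‖c‖ * C, fun w => ?_⟩
    rw [map_smul, norm_smul]
    exact mul_le_mul_of_nonneg_left (hC w) (norm_nonneg c)

theorem boundedOrbits_le_comap (T : ι → Module.End ℝ E) (i : ι) :
    boundedOrbits T ≤ (boundedOrbits T).comap (T i) := by
  rintro x ⟨C, hC⟩
  refine ⟨C, fun w => ?_⟩
  simpa [wordProd_append, wordProd_cons] using hC (w ++ [i])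

/-- The supremum of the norm along the orbit, on the space of vectors with bounded orbit. -/
noncomputable def orbitNorm (T : ι → Module.End ℝ E) : Seminorm ℝ (boundedOrbits T) :=
  Seminorm.of (fun x => ⨆ w : List ι, ‖wordProd T w x‖)
    (by
      rintro ⟨x, C, hC⟩ ⟨y, D, hD⟩
      refine ciSup_le fun w => ?_
      simp only [Submodule.coe_add, map_add]
      refine (norm_add_le _ _).trans (add_le_add ?_ ?_)
      · exact le_ciSup (f := fun w : List ι => ‖wordProd T w x‖)
          ⟨C, by rintro _ ⟨w, rfl⟩; exact hC w⟩ w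
      · exact le_ciSup (f := fun w : List ι => ‖wordProd T w y‖)
          ⟨D, by rintro _ ⟨w, rfl⟩; exact hD w⟩ w)
    (by
      intro c x
      simp only [Submodule.coe_smul, map_smul, norm_smul]
      rw [Real.mul_iSup_of_nonneg (norm_nonneg c)])

theorem norm_wordProd_le_orbitNorm (T : ι → Module.End ℝ E) (x : boundedOrbits T) (w : List ι) :
    ‖wordProd T w x‖ ≤ orbitNorm T x := by
  obtain ⟨x, C, hC⟩ := x
  exact le_ciSup (f := fun w : List ι => ‖wordProd T w x‖)
          ⟨C, by rintro _ ⟨w, rfl⟩; exact hC w⟩ w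

/-- The orbit of `T i x` is part of the orbit of `x`: append the letter `i` on the right of each
word. -/
theorem orbitNorm_apply_le (T : ι → Module.End ℝ E) (i : ι) (x y : boundedOrbits T)
    (hy : (y : E) = T i x) : orbitNorm T y ≤ orbitNorm T x := by
  refine ciSup_le fun w => ?_
  rw [hy]
  simpa [wordProd_append, wordProd_cons] using norm_wordProd_le_orbitNorm T x (w ++ [i])

variable [FiniteDimensional ℝ E]

/-- If no nonzero vector has a bounded orbit, then already a finite subfamily has unbounded
orbits. -/
theorem exists_finset_unbounded_orbit [Nontrivial E] (T : ι → Module.End ℝ E)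
    (h : boundedOrbits T = ⊥) :
    ∃ (F : Finset ι) (x : E), ∀ C : ℝ, ∃ w : List ι, (∀ i ∈ w, i ∈ F) ∧ C < ‖wordProd T w x‖ := by
  classical
  -- A vector whose orbit stays below 2 would lie in `boundedOrbits T`; any threshold above 1 would
  -- serve.
  have h1 : ∀ x : E, x ≠ 0 → ∃ w : List ι, 2 < ‖wordProd T w x‖ := by
    intro x hx
    by_contra! hw
    have : x ∈ boundedOrbits T := ⟨2, hw⟩
    rw [h] at this
    exact hx (by simpa using this)
  have hcont : ∀ w : List ι, Continuous fun x => ‖wordProd T w x‖ := fun w =>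
    (LinearMap.continuous_of_finiteDimensional (wordProd T w)).norm
  -- By compactness finitely many words suffice to double every vector. Their letters form the
  -- finite subfamily, and concatenating them gives growth $2^n$.
  obtain ⟨W, hW⟩ := (isCompact_sphere (0 : E) 1).elim_finite_subcover
    (fun w : List ι => {x : E | 2 < ‖wordProd T w x‖})
    (fun w => isOpen_lt continuous_const (hcont w))
    (fun x hx => by
      have : x ≠ 0 := by rintro rfl; simp at hx
      simpa using h1 x this)
  have hgrow : ∀ x : E, x ≠ 0 → ∃ w ∈ W, 2 * ‖x‖ < ‖wordProd T w x‖ := by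
    intro x hx
    have hx' : 0 < ‖x‖ := norm_pos_iff.2 hx
    have : ‖x‖⁻¹ • x ∈ Metric.sphere (0 : E) 1 := by simp [norm_smul, hx]
    have := hW this
    simp only [Set.mem_iUnion, Set.mem_ofPred_eq, map_smul, norm_smul, norm_inv, norm_norm] at this
    obtain ⟨w, hw, hlt⟩ := this
    refine ⟨w, hw, ?_⟩
    rwa [← div_eq_inv_mul, lt_div_iff₀ hx'] at hlt
  obtain ⟨x, hx⟩ := exists_ne (0 : E)
  have hx' : 0 < ‖x‖ := norm_pos_iff.2 hx
  refine ⟨W.biUnion fun w => w.toFinset, x, fun C => ?_⟩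
  have hpow : ∀ n : ℕ, ∃ w : List ι, (∀ i ∈ w, i ∈ W.biUnion fun w => w.toFinset) ∧
      2 ^ n * ‖x‖ ≤ ‖wordProd T w x‖ := by
    intro n
    induction n with
    | zero => exact ⟨[], by simp, by simp⟩
    | succ n ih =>
      obtain ⟨w, hwF, hw⟩ := ih
      have hne : wordProd T w x ≠ 0 := by
        rw [← norm_pos_iff]
        exact lt_of_lt_of_le (by positivity) hw
      obtain ⟨v, hv, hlt⟩ := hgrow _ hne
      refine ⟨v ++ w, ?_, ?_⟩
      · intro i hi
        rcases List.mem_append.1 hi with hi | hi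
        · exact Finset.mem_biUnion.2 ⟨v, hv, by simpa using hi⟩
        · exact hwF i hi
      · rw [wordProd_append, pow_succ]
        linarith
  obtain ⟨n, hn⟩ := pow_unbounded_of_one_lt (C / ‖x‖) one_lt_two
  obtain ⟨w, hwF, hw⟩ := hpow n
  rw [div_lt_iff₀ hx'] at hn
  exact ⟨w, hwF, hn.trans_le hw⟩

end Normed

/-- A bounded family of operators, all of whose finite subfamilies generate bounded semigroups,
is contracted by some norm up to a factor arbitrarily close to `1`. -/
theorem exists_norm_apply_le {ι : Type*} (n : ℕ) : ∀ {E : Type*} [NormedAddCommGroup E]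
    [NormedSpace ℝ E] [FiniteDimensional ℝ E] (T : ι → Module.End ℝ E) (B : ℝ),
    (∀ i x, ‖T i x‖ ≤ B * ‖x‖) →
    (∀ (F : Finset ι) (x : E), ∃ C : ℝ, ∀ w : List ι, (∀ i ∈ w, i ∈ F) → ‖wordProd T w x‖ ≤ C) →
    Module.finrank ℝ E = n → ∀ δ : ℝ, 0 < δ →
    ∃ N : Seminorm ℝ E, (∀ x, N x = 0 → x = 0) ∧ ∀ i x, N (T i x) ≤ (1 + δ) * N x := by
  induction n using Nat.strong_induction_on with
  | _ n ih =>
  intro E _ _ _ T B hB hT hn δ hδ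
  rcases subsingleton_or_nontrivial E with hE | hE
  · refine ⟨0, fun x _ => Subsingleton.elim _ _, fun i x => by simp⟩
  set V := boundedOrbits T with hVdef
  have hVbot : V ≠ ⊥ := by
    intro h
    obtain ⟨F, x, hFx⟩ := exists_finset_unbounded_orbit T h
    obtain ⟨C, hC⟩ := hT F x
    obtain ⟨w, hw, hlt⟩ := hFx C
    exact absurd (hC w hw) (not_le.2 hlt)
  have hVinv : ∀ i, V ≤ V.comap (T i) := boundedOrbits_le_comap T
  have : IsClosed (V : Set E) := V.closed_of_finiteDimensional
  -- The family is block triangular along `V`, so induction applies to the quotient. Half of the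
  -- slack is kept for the off-diagonal block.
  obtain ⟨N₂, hN₂, hN₂T⟩ := ih (Module.finrank ℝ (E ⧸ V))
    (by
      have h1 := V.finrank_quotient_add_finrank
      have h2 : 0 < Module.finrank ℝ V := by
        rw [Module.finrank_pos_iff]
        exact Submodule.nontrivial_iff_ne_bot.2 hVbot
      omega)
    (fun i => V.mapQ V (T i) (hVinv i)) (max B 0)
    (fun i q => by
      -- The quotient norm is an infimum, so a representative is only nearly optimal.
      refine le_of_forall_pos_le_add fun ε hε => ?_
      have hε' : 0 < ε / (max B 0 + 1) := by positivity
      obtain ⟨x, rfl, hx⟩ := Submodule.Quotient.norm_mk_lt q hε'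
      rw [Submodule.mapQ_apply]
      refine (Submodule.Quotient.norm_mk_le _ _).trans ((hB i x).trans ?_)
      calc B * ‖x‖ ≤ max B 0 * ‖x‖ := by gcongr; exact le_max_left _ _
        _ ≤ max B 0 * (‖(Submodule.Quotient.mk x : E ⧸ V)‖ + ε / (max B 0 + 1)) := by gcongr
        _ = max B 0 * ‖(Submodule.Quotient.mk x : E ⧸ V)‖
            + (max B 0 / (max B 0 + 1)) * ε := by ring
        _ ≤ _ := by
          gcongr
          refine mul_le_of_le_one_left hε.le ?_
          rw [div_le_one (by positivity)]
          linarith)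
    (fun F q => by
      obtain ⟨x, rfl⟩ := Submodule.Quotient.mk_surjective V q
      obtain ⟨C, hC⟩ := hT F x
      refine ⟨C, fun w hw => ?_⟩
      rw [wordProd_mapQ]
      exact (Submodule.Quotient.norm_mk_le _ _).trans (hC w hw))
    rfl (δ / 2) (by positivity)
  obtain ⟨π, hπ⟩ := LinearMap.exists_leftInverse_of_injective V.subtype V.ker_subtype
  have hπV : ∀ v : V, π v = v := fun v => by
    simpa using LinearMap.congr_fun hπ v
  -- the complement of the projection, as a function on the quotient
  set R : (E ⧸ V) →ₗ[ℝ] E := V.liftQ (LinearMap.id - V.subtype ∘ₗ π) (by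
    intro v hv
    simp [hπV ⟨v, hv⟩]) with hR
  have hRmk : ∀ x : E, R (Submodule.Quotient.mk x) = x - π x := fun x => by simp [hR]
  obtain ⟨C₁, hC₁, h₁⟩ := exists_seminorm_le_mul_norm ((orbitNorm T).comp π)
  obtain ⟨C₂, hC₂, h₂⟩ := exists_seminorm_le_mul ((normSeminorm ℝ E).comp R) N₂ hN₂
  have hB0 : ∀ i x, ‖T i x‖ ≤ max B 0 * ‖x‖ := fun i x =>
    (hB i x).trans (by gcongr; exact le_max_left _ _)
  -- The quotient part gets a weight so large that `L * (δ / 2)` exceeds the norm of the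
  -- off-diagonal block; the `+ 1` keeps it positive.
  set L : ℝ := C₁ * max B 0 * C₂ * (2 / δ) + 1 with hL
  have hLpos : 0 < L := by positivity
  have hcross : ∀ i x, orbitNorm T (π (T i (x - π x)))
      ≤ C₁ * max B 0 * C₂ * N₂ (Submodule.Quotient.mk x) := by
    intro i x
    calc orbitNorm T (π (T i (x - π x))) ≤ C₁ * ‖T i (x - π x)‖ := h₁ _
      _ ≤ C₁ * (max B 0 * ‖x - π x‖) := by gcongr; exact hB0 i _
      _ ≤ C₁ * (max B 0 * (C₂ * N₂ (Submodule.Quotient.mk x))) := by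
        gcongr
        have := h₂ (Submodule.Quotient.mk x)
        rwa [Seminorm.comp_apply, hRmk] at this
      _ = _ := by ring
  have hN : ∀ x, ((orbitNorm T).comp π + L.toNNReal • N₂.comp V.mkQ) x
      = orbitNorm T (π x) + L * N₂ (Submodule.Quotient.mk x) := fun x => by
    simp [NNReal.smul_def, hLpos.le]
  refine ⟨(orbitNorm T).comp π + L.toNNReal • N₂.comp V.mkQ, fun x hx => ?_, fun i x => ?_⟩
  · rw [hN] at hx
    have a1 := apply_nonneg (orbitNorm T) (π x)
    have a2 := apply_nonneg N₂ (Submodule.Quotient.mk x)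
    have a3 : N₂ (Submodule.Quotient.mk x) = 0 := by nlinarith
    have hxV : x ∈ V := (Submodule.Quotient.mk_eq_zero V).1 (hN₂ _ a3)
    have a4 : orbitNorm T (π x) = 0 := by simpa [a3] using hx
    have a5 := norm_wordProd_le_orbitNorm T (π x) []
    rw [hπV ⟨x, hxV⟩] at a4 a5
    simpa [a4] using a5
  · rw [hN, hN]
    have b1 : orbitNorm T (π (T i x)) ≤ orbitNorm T (π x)
        + C₁ * max B 0 * C₂ * N₂ (Submodule.Quotient.mk x) := by
      -- The first term stays in `V`, where the orbit norm does not increase; the second is the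
      -- off-diagonal block.
      have : π (T i x) = π (T i (π x)) + π (T i (x - π x)) := by
        rw [← map_add, ← map_add, add_sub_cancel]
      rw [this]
      refine (map_add_le_add _ _ _).trans (add_le_add ?_ (hcross i x))
      refine orbitNorm_apply_le T i _ _ ?_
      exact congrArg Subtype.val (hπV ⟨T i (π x), hVinv i (π x).2⟩)
    have b2 : N₂ (Submodule.Quotient.mk (T i x)) ≤ (1 + δ / 2) * N₂ (Submodule.Quotient.mk x) :=
      hN₂T i (Submodule.Quotient.mk x)
    have b3 : C₁ * max B 0 * C₂ ≤ L * (δ / 2) := by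
      have : L * (δ / 2) = C₁ * max B 0 * C₂ + δ / 2 := by
        rw [hL]; field_simp
      rw [this]; linarith
    have a1 := apply_nonneg (orbitNorm T) (π x)
    have a2 := apply_nonneg N₂ (Submodule.Quotient.mk x)
    have b4 := mul_le_mul_of_nonneg_left b2 hLpos.le
    have b5 := mul_le_mul_of_nonneg_right b3 a2
    nlinarith [mul_nonneg hδ.le a1]

/-! ### Uniform exponential decay and contraction norms for the deterministic system -/

section Deterministic

variable {d : ℕ}

theorem trajectory_congr {A A' : ℕ → Mat d} (x : Fin d → ℝ) {k : ℕ}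
    (h : ∀ j < k, A j = A' j) : trajectory A x k = trajectory A' x k := by
  induction k with
  | zero => rfl
  | succ k ih =>
    rw [trajectory, trajectory, ih fun j hj => h j (by omega), h k (by omega)]

theorem trajectory_add_time (A : ℕ → Mat d) (x : Fin d → ℝ) (m n : ℕ) :
    trajectory A x (m + n) = trajectory (fun j => A (m + j)) (trajectory A x m) n := by
  induction n with
  | zero => rfl
  | succ n ih => rw [← add_assoc, trajectory, ih, trajectory]

theorem trajectory_add (A : ℕ → Mat d) (x y : Fin d → ℝ) (k : ℕ) :
    trajectory A (x + y) k = trajectory A x k + trajectory A y k := by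
  induction k with
  | zero => rfl
  | succ k ih => simp only [trajectory, ih, Matrix.mulVec_add]

theorem trajectory_smul (A : ℕ → Mat d) (c : ℝ) (x : Fin d → ℝ) (k : ℕ) :
    trajectory A (c • x) k = c • trajectory A x k := by
  induction k with
  | zero => rfl
  | succ k ih => simp only [trajectory, ih, Matrix.mulVec_smul]

theorem continuous_trajectory (k : ℕ) :
    Continuous fun q : (ℕ → Mat d) × (Fin d → ℝ) => trajectory q.1 q.2 k := by
  induction k with
  | zero => exact continuous_snd
  | succ k ih => exact ((continuous_apply k).comp continuous_fst).matrix_mulVec ih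

theorem exists_norm_mulVec_le {S : Set (Mat d)} (hS : IsCompact S) :
    ∃ B : ℝ, 1 ≤ B ∧ ∀ M ∈ S, ∀ x, ‖M.mulVec x‖ ≤ B * ‖x‖ := by
  have hcont : Continuous fun M : Mat d => ∑ i, ∑ j, |M i j| := by fun_prop
  obtain ⟨B, hB⟩ := (hS.image hcont).bddAbove
  refine ⟨max B 1, le_max_right _ _, fun M hM x => ?_⟩
  have hMB : ∑ i, ∑ j, |M i j| ≤ max B 1 := (hB ⟨M, hM, rfl⟩).trans (le_max_left _ _)
  rw [pi_norm_le_iff_of_nonneg (by positivity)]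
  intro i
  calc ‖M.mulVec x i‖ ≤ ∑ j, ‖M i j * x j‖ := by
        rw [Matrix.mulVec_eq_sum, Finset.sum_apply]
        refine (norm_sum_le _ _).trans_eq (Finset.sum_congr rfl fun j _ => ?_)
        simp
    _ ≤ ∑ j, |M i j| * ‖x‖ := by
      refine Finset.sum_le_sum fun j _ => ?_
      rw [norm_mul, Real.norm_eq_abs]
      gcongr
      exact norm_le_pi_norm x j
    _ = (∑ j, |M i j|) * ‖x‖ := by rw [Finset.sum_mul]
    _ ≤ (∑ i, ∑ j, |M i j|) * ‖x‖ := by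
      refine mul_le_mul_of_nonneg_right ?_ (norm_nonneg x)
      exact Finset.single_le_sum (f := fun i => ∑ j, |M i j|)
        (fun _ _ => Finset.sum_nonneg fun _ _ => abs_nonneg _) (Finset.mem_univ i)
    _ ≤ _ := by gcongr

theorem norm_trajectory_le {S : Set (Mat d)} {B : ℝ} (hB1 : 1 ≤ B)
    (hB : ∀ M ∈ S, ∀ x, ‖M.mulVec x‖ ≤ B * ‖x‖) {A : ℕ → Mat d} (hA : ∀ k, A k ∈ S)
    (x : Fin d → ℝ) (k : ℕ) : ‖trajectory A x k‖ ≤ B ^ k * ‖x‖ := by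
  induction k with
  | zero => simp [trajectory]
  | succ k ih =>
    rw [trajectory, pow_succ', mul_assoc]
    exact (hB _ (hA k) _).trans (by gcongr)

/-- By compactness, an absolutely asymptotically stable system halves every state within a
uniformly bounded time. -/
theorem AbsolutelyAsymptoticallyStable.exists_uniform_halving {S : Set (Mat d)}
    (hS : IsCompact S) (h : AbsolutelyAsymptoticallyStable S) :
    ∃ m : ℕ, ∀ A : ℕ → Mat d, (∀ k, A k ∈ S) → ∀ x : Fin d → ℝ, x ≠ 0 →
      ∃ k, 1 ≤ k ∧ k ≤ m ∧ ‖trajectory A x k‖ ≤ 1 / 2 * ‖x‖ := by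
  -- Tychonoff: switching sequences form a compact space, and the state at time `k` is continuous in
  -- the sequence and the initial vector jointly.
  have hcpt : IsCompact ((Set.univ.pi fun _ : ℕ => S) ×ˢ Metric.sphere (0 : Fin d → ℝ) 1) :=
    (isCompact_univ_pi fun _ => hS).prod (isCompact_sphere _ _)
  obtain ⟨W, hW⟩ := hcpt.elim_finite_subcover
    (fun k : ℕ => {q : (ℕ → Mat d) × (Fin d → ℝ) | ‖trajectory q.1 q.2 k‖ < 1 / 2})
    (fun k => isOpen_lt (continuous_trajectory k).norm continuous_const)
    (by
      rintro ⟨A, x⟩ ⟨hA, hx⟩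
      have ht := (h A (fun k => hA k trivial) x).norm
      rw [norm_zero] at ht
      obtain ⟨k, hk⟩ := (ht.eventually (gt_mem_nhds (by norm_num : (0 : ℝ) < 1 / 2))).exists
      exact Set.mem_iUnion.2 ⟨k, hk⟩)
  refine ⟨W.sup id, fun A hA x hx => ?_⟩
  have hx' : 0 < ‖x‖ := norm_pos_iff.2 hx
  have hmem := hW (show (A, ‖x‖⁻¹ • x) ∈ _ from ⟨fun k _ => hA k, by simp [norm_smul, hx]⟩)
  obtain ⟨k, hkW, hk⟩ := Set.mem_iUnion₂.1 hmem
  replace hk : ‖trajectory A (‖x‖⁻¹ • x) k‖ < 1 / 2 := hk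
  refine ⟨k, ?_, Finset.le_sup (f := id) hkW, ?_⟩
  · rcases k.eq_zero_or_pos with rfl | hk0
    · rw [trajectory, norm_smul, norm_inv, norm_norm, inv_mul_cancel₀ hx'.ne'] at hk
      norm_num at hk
    · exact hk0
  · rw [trajectory_smul, norm_smul, norm_inv, norm_norm, ← div_eq_inv_mul,
      div_lt_iff₀ hx'] at hk
    exact hk.le

/-- Restarting at each halving time halves the state again within at most `m` further steps; growth
between halving times is bounded because the matrices are. -/
theorem AbsolutelyAsymptoticallyStable.exists_exponential_bound {S : Set (Mat d)}
    (hS : IsCompact S) (h : AbsolutelyAsymptoticallyStable S) :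
    ∃ C θ : ℝ, 0 < C ∧ 0 < θ ∧ θ < 1 ∧ ∀ A : ℕ → Mat d, (∀ k, A k ∈ S) →
      ∀ (x : Fin d → ℝ) (k : ℕ), ‖trajectory A x k‖ ≤ C * θ ^ k * ‖x‖ := by
  obtain ⟨m, hm⟩ := h.exists_uniform_halving hS
  obtain ⟨B, hB1, hB⟩ := exists_norm_mulVec_le hS
  -- The exponent `m + 1` rather than `m` keeps the root defined when `m = 0`.
  obtain ⟨θ, hθ0, hθ1, hθ⟩ : ∃ θ : ℝ, 0 < θ ∧ θ < 1 ∧ θ ^ (m + 1) = 1 / 2 := by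
    refine ⟨(1 / 2 : ℝ) ^ (((m + 1 : ℕ) : ℝ)⁻¹), by positivity, ?_, ?_⟩
    · exact Real.rpow_lt_one (by norm_num) (by norm_num) (by positivity)
    · exact Real.rpow_inv_natCast_pow (by norm_num) (by omega)
  have hhalf : ∀ k ≤ m + 1, 1 / 2 ≤ θ ^ k := fun k hk =>
    hθ ▸ pow_le_pow_of_le_one hθ0.le hθ1.le hk
  refine ⟨2 * B ^ m, θ, by positivity, hθ0, hθ1, fun A hA x k => ?_⟩
  induction k using Nat.strong_induction_on generalizing A x with
  | _ k ih =>
  rcases eq_or_ne x 0 with rfl | hx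
  · have : trajectory A (0 : Fin d → ℝ) k = 0 := by
      simpa using trajectory_smul A 0 (0 : Fin d → ℝ) k
    simp [this]
  rcases le_or_gt k m with hkm | hkm
  · refine (norm_trajectory_le hB1 hB hA x k).trans ?_
    gcongr
    calc B ^ k ≤ B ^ m := pow_le_pow_right₀ hB1 hkm
      _ = 2 * B ^ m * (1 / 2) := by ring
      _ ≤ _ := by gcongr; exact hhalf k (by omega)
  · obtain ⟨j, hj1, hjm, hj⟩ := hm A hA x hx
    obtain ⟨n, rfl⟩ := Nat.exists_eq_add_of_le (show j ≤ k by omega)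
    rw [trajectory_add_time]
    refine (ih n (by omega) _ (fun i => hA _) _).trans ?_
    calc 2 * B ^ m * θ ^ n * ‖trajectory A x j‖
        ≤ 2 * B ^ m * θ ^ n * (1 / 2 * ‖x‖) := by gcongr
      _ ≤ 2 * B ^ m * θ ^ n * (θ ^ j * ‖x‖) := by gcongr; exact hhalf j (by omega)
      _ = _ := by ring

/-- Words in a family of matrices are the fundamental solutions of the switched system. -/
theorem exists_trajectory_eq_wordProd {ι : Type*} (M : ι → Mat d) (w : List ι) :
    ∃ A : ℕ → Mat d, (∀ j < w.length, ∃ i ∈ w, A j = M i) ∧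
      ∀ x, trajectory A x w.length = wordProd (fun i => (M i).mulVecLin) w x := by
  induction w with
  | nil => exact ⟨0, by simp, fun x => by simp [trajectory]⟩
  | cons i w ih =>
    obtain ⟨A, hA, hAx⟩ := ih
    -- The leftmost letter acts last, hence at time `w.length`.
    refine ⟨fun j => if j = w.length then M i else A j, fun j hj => ?_, fun x => ?_⟩
    · rcases eq_or_ne j w.length with rfl | hne
      · exact ⟨i, by simp, by simp⟩
      · obtain ⟨i', hi', h⟩ := hA j (by simp at hj; omega)
        exact ⟨i', by simp [hi'], by simp [hne, h]⟩
    · rw [List.length_cons, trajectory, wordProd_cons, ← hAx x, Matrix.mulVecLin_apply,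
        trajectory_congr (A' := A) x fun j hj => by simp [hj.ne]]
      simp

/-- A norm contracted by a family of matrices is contracted by its closure. -/
theorem absolutelyAsymptoticallyStable_of_seminorm {D S : Set (Mat d)} (hDS : S ⊆ closure D)
    (N : Seminorm ℝ (Fin d → ℝ)) (hN : ∀ x, N x = 0 → x = 0) {θ : ℝ} (hθ0 : 0 ≤ θ) (hθ1 : θ < 1)
    (hD : ∀ M ∈ D, ∀ x, N (M.mulVec x) ≤ θ * N x) : AbsolutelyAsymptoticallyStable S := by
  have hS : ∀ M ∈ S, ∀ x, N (M.mulVec x) ≤ θ * N x := by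
    intro M hM x
    have hclosed : IsClosed {M : Mat d | N (M.mulVec x) ≤ θ * N x} :=
      isClosed_le ((seminorm_continuous N).comp (continuous_id.matrix_mulVec continuous_const))
        continuous_const
    exact closure_minimal (fun M hM => hD M hM x) hclosed (hDS hM)
  intro A hA x
  have hdecay : ∀ k, N (trajectory A x k) ≤ θ ^ k * N x := by
    intro k
    induction k with
    | zero => simp [trajectory]
    | succ k ih =>
      rw [trajectory, pow_succ', mul_assoc]
      exact (hS _ (hA k) _).trans (by gcongr)
  obtain ⟨C, hC, hCN⟩ := exists_seminorm_le_mul (normSeminorm ℝ (Fin d → ℝ)) N hN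
  refine squeeze_zero_norm (a := fun k => C * (θ ^ k * N x)) (fun k => ?_) ?_
  · exact (hCN _).trans (by gcongr; exact hdecay k)
  · simpa using ((tendsto_pow_atTop_nhds_zero_of_lt_one hθ0 hθ1).mul_const (N x)).const_mul C

end Deterministic

/-! ### Proper cones, the induced order on matrices, and dominated matrices -/

section Cone

variable {d : ℕ}

theorem IsProperCone.add_mem {K : Set (Fin d → ℝ)} (hK : IsProperCone K) {x y : Fin d → ℝ}
    (hx : x ∈ K) (hy : y ∈ K) : x + y ∈ K := by
  have h := hK.smul_mem 2 (by norm_num) _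
    (hK.convex hx hy (by norm_num : (0 : ℝ) ≤ 1 / 2) (by norm_num : (0 : ℝ) ≤ 1 / 2) (by norm_num))
  simpa [smul_add, smul_smul] using h

/-- Proper cones in finite dimension are normal. -/
theorem IsProperCone.exists_norm_le {K : Set (Fin d → ℝ)} (hK : IsProperCone K) :
    ∃ c : ℝ, 0 < c ∧ ∀ a b : Fin d → ℝ, a ∈ K → b - a ∈ K → ‖a‖ ≤ c * ‖b‖ := by
  rcases (Metric.sphere (0 : Fin d → ℝ) 1 ∩ K).eq_empty_or_nonempty with h | h
  · refine ⟨1, one_pos, fun a b ha _ => ?_⟩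
    have ha0 : a = 0 := by
      by_contra ha0
      have : ‖a‖⁻¹ • a ∈ Metric.sphere (0 : Fin d → ℝ) 1 ∩ K :=
        ⟨by simp [norm_smul, ha0], hK.smul_mem _ (by positivity) _ ha⟩
      simp [h] at this
    simp [ha0]
  have hKne : K.Nonempty := h.mono Set.inter_subset_right
  -- Pointedness keeps `-a` at positive distance from `K` for unit `a ∈ K`, and compactness makes
  -- this uniform. Since `b - a ∈ K` lies at distance `‖b‖` from `-a`, this bounds `‖a‖` by `‖b‖`.
  obtain ⟨u, ⟨hu1, huK⟩, hmin⟩ := ((isCompact_sphere (0 : Fin d → ℝ) 1).inter_right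
    hK.isClosed).exists_isMinOn h
    (f := fun a => Metric.infDist (-a) K)
    ((Metric.continuous_infDist_pt K).comp continuous_neg).continuousOn
  have hu1 : ‖u‖ = 1 := by simpa using hu1
  have hpos : 0 < Metric.infDist (-u) K := by
    rw [← hK.isClosed.notMem_iff_infDist_pos hKne]
    intro hneg
    have := hK.pointed u huK hneg
    simp [this] at hu1
  refine ⟨(Metric.infDist (-u) K)⁻¹, inv_pos.2 hpos, fun a b ha hab => ?_⟩
  rcases eq_or_ne a 0 with rfl | ha0
  · simp only [norm_zero]; positivity
  have ha' : 0 < ‖a‖ := norm_pos_iff.2 ha0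
  have h1 : Metric.infDist (-u) K ≤ Metric.infDist (-(‖a‖⁻¹ • a)) K :=
    hmin ⟨by simp [norm_smul, ha0], hK.smul_mem _ (by positivity) _ ha⟩
  have h2 : Metric.infDist (-(‖a‖⁻¹ • a)) K ≤ dist (-(‖a‖⁻¹ • a)) (‖a‖⁻¹ • (b - a)) :=
    Metric.infDist_le_dist_of_mem (hK.smul_mem _ (by positivity) _ hab)
  have h3 : dist (-(‖a‖⁻¹ • a)) (‖a‖⁻¹ • (b - a)) = ‖a‖⁻¹ * ‖b‖ := by
    rw [dist_eq_norm, ← norm_neg, smul_sub]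
    simp [norm_smul]
  rw [h3, ← div_eq_inv_mul] at h2
  have h4 := h1.trans h2
  rw [le_div_iff₀ ha'] at h4
  rwa [← div_eq_inv_mul, le_div_iff₀ hpos, mul_comm]

/-- The matrices leaving the set `K` invariant. -/
def coneMaps (K : Set (Fin d → ℝ)) : Set (Mat d) := {M | ∀ x ∈ K, M.mulVec x ∈ K}

theorem isClosed_coneMaps {K : Set (Fin d → ℝ)} (hK : IsProperCone K) :
    IsClosed (coneMaps K) := by
  have : coneMaps K = ⋂ x ∈ K, (fun M : Mat d => M.mulVec x) ⁻¹' K := by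
    ext M; simp [coneMaps]
  rw [this]
  exact isClosed_biInter fun x _ =>
    hK.isClosed.preimage (continuous_id.matrix_mulVec continuous_const)

theorem convex_coneMaps {K : Set (Fin d → ℝ)} (hK : IsProperCone K) : Convex ℝ (coneMaps K) := by
  intro M hM M' hM' a b ha hb hab x hx
  rw [Matrix.add_mulVec, Matrix.smul_mulVec, Matrix.smul_mulVec]
  exact hK.convex (hM x hx) (hM' x hx) ha hb hab

theorem smul_mem_coneMaps {K : Set (Fin d → ℝ)} (hK : IsProperCone K) {c : ℝ} (hc : 0 ≤ c)
    {M : Mat d} (hM : M ∈ coneMaps K) : c • M ∈ coneMaps K := by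
  intro x hx
  rw [Matrix.smul_mulVec]
  exact hK.smul_mem c hc _ (hM x hx)

/-- Frontiers of convex sets are Lebesgue-null. Hence the absolutely continuous part of `μ` is
carried by interior points of `coneMaps K`. -/
theorem lebesgue_frontier_coneMaps {K : Set (Fin d → ℝ)} (hK : IsProperCone K) :
    lebesgue d (frontier (coneMaps K)) = 0 := by
  have h : lebesgue d = (volume : Measure (Fin d → Fin d → ℝ)) := Measure.map_id
  rw [h]
  exact Convex.addHaar_frontier (E := Fin d → Fin d → ℝ) volume (convex_coneMaps hK)

theorem trajectory_mem_cone {K : Set (Fin d → ℝ)} {A : ℕ → Mat d} {x : Fin d → ℝ} (hx : x ∈ K)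
    {k : ℕ} (hA : ∀ j < k, A j ∈ coneMaps K) : trajectory A x k ∈ K := by
  induction k with
  | zero => exact hx
  | succ k ih => exact hA k (by omega) _ (ih fun j hj => hA j (by omega))

/-- Monotonicity of trajectories with respect to the order of the cone. -/
theorem trajectory_sub_smul_mem {K : Set (Fin d → ℝ)} (hK : IsProperCone K) {q : ℝ} (hq : 0 ≤ q)
    {A M : ℕ → Mat d} {x : Fin d → ℝ} (hx : x ∈ K) {k : ℕ} (hA : ∀ j < k, A j ∈ coneMaps K)
    (hM : ∀ j < k, M j ∈ coneMaps K) (hAM : ∀ j < k, A j - q • M j ∈ coneMaps K) :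
    trajectory A x k - q ^ k • trajectory M x k ∈ K := by
  induction k with
  | zero =>
    simpa [trajectory] using hK.smul_mem 0 le_rfl x hx
  | succ k ih =>
    -- With $a,m$ the two states at time $k$, $A_ka-q^{k+1}M_km=A_k(a-q^km)+q^k(A_k-qM_k)m$, and
    -- both summands lie in the cone.
    have h1 := hA k (by omega) _ (ih (fun j hj => hA j (by omega)) (fun j hj => hM j (by omega))
      fun j hj => hAM j (by omega))
    have h2 := hK.smul_mem _ (pow_nonneg hq k) _
      (hAM k (by omega) _ (trajectory_mem_cone hx fun j hj => hM j (Nat.lt_succ_of_lt hj)))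
    have h3 := hK.add_mem h1 h2
    simp only [trajectory]
    convert h3 using 1
    rw [Matrix.mulVec_sub, Matrix.sub_mulVec, Matrix.mulVec_smul, Matrix.smul_mulVec, smul_sub,
      smul_smul, ← pow_succ]
    abel

/-- The orbit of an interior point of the cone dominates all other orbits. -/
theorem exists_norm_trajectory_le_interior {K : Set (Fin d → ℝ)} (hK : IsProperCone K)
    {e : Fin d → ℝ} (he : e ∈ interior K) (x : Fin d → ℝ) :
    ∃ C : ℝ, 0 < C ∧ ∀ (A : ℕ → Mat d) (k : ℕ), (∀ j < k, A j ∈ coneMaps K) →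
      ‖trajectory A x k‖ ≤ C * ‖trajectory A e k‖ := by
  obtain ⟨c, hc, hcK⟩ := hK.exists_norm_le
  have hnear : ∀ᶠ t : ℝ in 𝓝[>] 0, e + t • x ∈ K ∧ e - t • x ∈ K := by
    refine Filter.Eventually.filter_mono nhdsWithin_le_nhds (Filter.Eventually.and ?_ ?_)
    · have : Tendsto (fun t : ℝ => e + t • x) (𝓝 0) (𝓝 e) := by
        have : Continuous fun t : ℝ => e + t • x := by fun_prop
        simpa using this.tendsto 0
      exact this (mem_interior_iff_mem_nhds.1 he)
    · have : Tendsto (fun t : ℝ => e - t • x) (𝓝 0) (𝓝 e) := by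
        have : Continuous fun t : ℝ => e - t • x := by fun_prop
        simpa using this.tendsto 0
      exact this (mem_interior_iff_mem_nhds.1 he)
  obtain ⟨t, ⟨h1, h2⟩, ht⟩ := (hnear.and self_mem_nhdsWithin).exists
  have ht : 0 < t := ht
  refine ⟨t⁻¹ * (2 * c + 1), by positivity, fun A k hA => ?_⟩
  have m1 := trajectory_mem_cone h1 hA
  have m2 := trajectory_mem_cone h2 hA
  rw [trajectory_add, trajectory_smul] at m1
  rw [sub_eq_add_neg, ← neg_smul, trajectory_add, trajectory_smul] at m2
  set a := trajectory A e k
  set b := trajectory A x k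
  -- Both `a + t • b` and `a - t • b` lie in the cone, so normality applies to $0\le a+tb\le 2a$.
  have h3 := hcK (a + t • b) ((2 : ℝ) • a) m1 (by convert m2 using 1; rw [two_smul, neg_smul]; abel)
  rw [norm_smul, Real.norm_ofNat] at h3
  have h4 : ‖t • b‖ ≤ ‖a + t • b‖ + ‖a‖ := by
    calc ‖t • b‖ = ‖(a + t • b) - a‖ := by rw [add_sub_cancel_left]
      _ ≤ _ := norm_sub_le _ _
  rw [norm_smul, Real.norm_of_nonneg ht.le] at h4
  rw [mul_assoc, ← div_eq_inv_mul, le_div_iff₀ ht]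
  nlinarith

/-- The points of the support of `μ` whose multiples by `q < 1` are dominated, in the order of the
cone `K`, with positive probability. -/
def dominatedSupport (μ : Measure (Mat d)) (K : Set (Fin d → ℝ)) : Set (Mat d) :=
  {M | M ∈ μ.support ∧ ∀ q : ℝ, 0 < q → q < 1 → 0 < μ {A | A - q • M ∈ coneMaps K}}

/-- An atom dominates its own multiples by `q < 1`. An open set meeting the support but free of
atoms carries only absolutely continuous mass, so it contains support points interior to `coneMaps
K`; every matrix close to such a point dominates `q` times it. -/
theorem support_subset_closure_dominatedSupport (μ : Measure (Mat d)) [IsProbabilityMeasure μ]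
    {K : Set (Fin d → ℝ)} (hK : IsProperCone K) (hinv : LeavesInvariant μ.support K)
    (hatom : ∃ (N : ℕ) (p : Fin N → ℝ) (M : Fin N → Mat d), (∀ i, 0 < p i) ∧
      μ.singularPart (lebesgue d) = ∑ i, ENNReal.ofReal (p i) • Measure.dirac (M i)) :
    μ.support ⊆ closure (dominatedSupport μ K) := by
  obtain ⟨n, p, M, hp, hsing⟩ := hatom
  intro M₀ hM₀
  rw [mem_closure_iff]
  intro U hU hMU
  have hμU : 0 < μ U := (Measure.mem_support_iff_forall _).1 hM₀ U (hU.mem_nhds hMU)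
  have hdec := Measure.haveLebesgueDecomposition_add μ (lebesgue d)
  by_cases hat : ∃ i, M i ∈ U
  · obtain ⟨i, hi⟩ := hat
    have hpos : ∀ s : Set (Mat d), M i ∈ s → 0 < μ s := by
      intro s hs
      refine lt_of_lt_of_le ?_ (Measure.singularPart_le μ (lebesgue d) s)
      rw [hsing, Measure.finsetSum_apply]
      refine lt_of_lt_of_le ?_ (Finset.single_le_sum
        (f := fun i => (ENNReal.ofReal (p i) • Measure.dirac (M i)) s)
        (fun _ _ => zero_le) (Finset.mem_univ i))
      simp [hs, hp i]
    have hsupp : M i ∈ μ.support :=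
      (Measure.mem_support_iff_forall _).2 fun s hs => hpos s (mem_of_mem_nhds hs)
    refine ⟨M i, hi, hsupp, fun q _ hq1 => hpos _ ?_⟩
    have : M i - q • M i = (1 - q) • M i := by rw [sub_smul, one_smul]
    rw [Set.mem_ofPred_eq, this]
    exact smul_mem_coneMaps hK (by linarith) (hinv _ hsupp)
  · push Not at hat
    have hs0 : μ.singularPart (lebesgue d) U = 0 := by
      rw [hsing, Measure.finsetSum_apply]
      refine Finset.sum_eq_zero fun i _ => ?_
      simp [hU.measurableSet, hat i]
    set ν := (lebesgue d).withDensity (μ.rnDeriv (lebesgue d)) with hν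
    have hνU : 0 < ν U := by
      have : μ U = μ.singularPart (lebesgue d) U + ν U := by
        conv_lhs => rw [hdec]
        rfl
      rwa [this, hs0, zero_add] at hμU
    have hνsupp : ν μ.supportᶜ = 0 :=
      le_antisymm ((Measure.withDensity_rnDeriv_le μ (lebesgue d) _).trans
        Measure.measure_compl_support.le) zero_le
    have hνfr : ν (frontier (coneMaps K)) = 0 :=
      withDensity_absolutelyContinuous _ _ (lebesgue_frontier_coneMaps hK)
    have hne : (U \ (μ.supportᶜ ∪ frontier (coneMaps K))).Nonempty := by
      refine nonempty_of_measure_ne_zero (μ := ν) ?_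
      rw [measure_sdiff_null (measure_union_null hνsupp hνfr)]
      exact hνU.ne'
    obtain ⟨M', hM'U, hM'⟩ := hne
    simp only [Set.mem_union, Set.mem_compl_iff, not_or, not_not] at hM'
    obtain ⟨hM's, hM'f⟩ := hM'
    have hint : M' ∈ interior (coneMaps K) := by
      by_contra hni
      exact hM'f ⟨subset_closure (hinv _ hM's), hni⟩
    refine ⟨M', hM'U, hM's, fun q hq0 hq1 => ?_⟩
    refine (Measure.mem_support_iff_forall _).1 hM's _ ?_
    -- This map fixes `M'`, so it sends matrices near `M'` into `coneMaps K`.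
    have hcont : Continuous fun A : Mat d => (1 - q)⁻¹ • (A - q • M') := by fun_prop
    have hval : (1 - q)⁻¹ • (M' - q • M') = M' := by
      have : M' - q • M' = (1 - q) • M' := by rw [sub_smul, one_smul]
      rw [this, smul_smul, inv_mul_cancel₀ (by linarith), one_smul]
    have hnh : coneMaps K ∈ 𝓝 ((1 - q)⁻¹ • (M' - q • M')) := by
      rw [hval]; exact mem_interior_iff_mem_nhds.1 hint
    filter_upwards [hcont.continuousAt hnh] with A hA
    have := smul_mem_coneMaps hK (sub_nonneg.2 hq1.le) hA
    rwa [smul_smul, mul_inv_cancel₀ (by linarith), one_smul] at this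

end Cone

/-! ### Mean growth against deterministic growth -/

section Probability

variable {d : ℕ} {Ω : Type*} [MeasurableSpace Ω] {P : Measure Ω} {μ : Measure (Mat d)}
  {A : ℕ → Ω → Mat d}

theorem FollowIndependently.ae_mem_support (hA : FollowIndependently A μ P) :
    ∀ᵐ ω ∂P, ∀ k, A k ω ∈ μ.support := by
  rw [ae_all_iff]
  intro k
  have h : ∀ᵐ M ∂(P.map (A k)), M ∈ μ.support := by
    rw [(hA.hasLaw k).map_eq]
    exact Measure.support_mem_ae
  exact ae_of_ae_map (hA.hasLaw k).aemeasurable h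

theorem FollowIndependently.aemeasurable_trajectory (hA : FollowIndependently A μ P)
    (x : Fin d → ℝ) (k : ℕ) : AEMeasurable (fun ω => trajectory (fun j => A j ω) x k) P := by
  induction k with
  | zero => exact aemeasurable_const
  | succ k ih =>
    have hc : Continuous fun q : Mat d × (Fin d → ℝ) => q.1.mulVec q.2 :=
      continuous_fst.matrix_mulVec continuous_snd
    exact hc.measurable.comp_aemeasurable ((hA.hasLaw k).aemeasurable.prodMk ih)

theorem FollowIndependently.integrable_pow [IsProbabilityMeasure P]
    (hA : FollowIndependently A μ P) (hcompact : IsCompact μ.support)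
    (nrm : Seminorm ℝ (Fin d → ℝ)) (p : ℕ) (x : Fin d → ℝ) (k : ℕ) :
    Integrable (fun ω => nrm (trajectory (fun j => A j ω) x k) ^ p) P := by
  obtain ⟨B, hB1, hB⟩ := exists_norm_mulVec_le hcompact
  obtain ⟨C, hC, hCn⟩ := exists_seminorm_le_mul_norm nrm
  refine Integrable.of_bound (C := (C * (B ^ k * ‖x‖)) ^ p) ?_ ?_
  · exact ((((seminorm_continuous nrm).measurable.comp_aemeasurable
      (hA.aemeasurable_trajectory x k))).pow_const p).aestronglyMeasurable
  · filter_upwards [hA.ae_mem_support] with ω hω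
    rw [norm_pow, Real.norm_of_nonneg (apply_nonneg nrm _)]
    refine pow_le_pow_left₀ (apply_nonneg nrm _) ((hCn _).trans ?_) p
    gcongr
    exact norm_trajectory_le hB1 hB hω x k

theorem meanPow_nonneg (nrm : Seminorm ℝ (Fin d → ℝ)) (p : ℕ) (x : Fin d → ℝ) (k : ℕ) :
    0 ≤ meanPow P nrm A p x k :=
  integral_nonneg fun _ => pow_nonneg (apply_nonneg nrm _) p

theorem FollowIndependently.pow_le_measureReal (hA : FollowIndependently A μ P)
    {S : ℕ → Set (Mat d)} (hS : ∀ j, MeasurableSet (S j)) {δ : ℝ} (hδ : 0 ≤ δ) {k : ℕ}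
    (h : ∀ j < k, δ ≤ μ.real (S j)) : δ ^ k ≤ P.real {ω | ∀ j < k, A j ω ∈ S j} := by
  have h1 := (iIndepFun_iff_measure_inter_preimage_eq_mul.1 hA.indep) (Finset.range k)
    (sets := S) fun j _ => hS j
  have h2 : {ω | ∀ j < k, A j ω ∈ S j} = ⋂ j ∈ Finset.range k, A j ⁻¹' S j := by
    ext ω; simp
  rw [h2, measureReal_def, h1, ENNReal.toReal_prod]
  calc δ ^ k = ∏ _j ∈ Finset.range k, δ := by simp
    _ ≤ _ := by
      refine Finset.prod_le_prod (fun _ _ => hδ) fun j hj => ?_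
      refine (h j (Finset.mem_range.1 hj)).trans_eq ?_
      rw [measureReal_def, ← (hA.hasLaw j).map_eq,
        Measure.map_apply_of_aemeasurable (hA.hasLaw j).aemeasurable (hS j)]

/-- A trajectory along matrices that are dominated with probability at least `δ` gives a lower
bound for the `p`th mean. -/
theorem FollowIndependently.pow_mul_pow_le_meanPow [IsProbabilityMeasure P]
    (hA : FollowIndependently A μ P) (hcompact : IsCompact μ.support)
    {nrm : Seminorm ℝ (Fin d → ℝ)} {K : Set (Fin d → ℝ)} (hK : IsProperCone K)
    (hinv : LeavesInvariant μ.support K) {c : ℝ} (hc : 0 < c)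
    (hcK : ∀ a b, a ∈ K → b - a ∈ K → ‖a‖ ≤ c * nrm b) {x : Fin d → ℝ} (hx : x ∈ K)
    {q δ : ℝ} (hq : 0 ≤ q) (hδ : 0 ≤ δ) {M : ℕ → Mat d} {k : ℕ}
    (hM : ∀ j < k, M j ∈ coneMaps K)
    (hMδ : ∀ j < k, δ ≤ μ.real {A | A - q • M j ∈ coneMaps K}) (p : ℕ) :
    δ ^ k * (q ^ k * ‖trajectory M x k‖) ^ p ≤ c ^ p * meanPow P nrm A p x k := by
  have hmeas : ∀ j, MeasurableSet {A : Mat d | A - q • M j ∈ coneMaps K} := fun j =>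
    ((isClosed_coneMaps hK).preimage (by fun_prop : Continuous fun A : Mat d => A - q • M j)
      ).measurableSet
  have hprob := hA.pow_le_measureReal hmeas hδ hMδ
  -- On the domination event, normality forces the `p`th power of the random state's norm above this
  -- threshold, up to a null set; Markov's inequality then applies.
  set ε : ℝ := (q ^ k * ‖trajectory M x k‖ / c) ^ p with hε
  have hmarkov := mul_meas_ge_le_integral_of_nonneg
    (Eventually.of_forall fun _ => pow_nonneg (apply_nonneg nrm _) p)
    (hA.integrable_pow hcompact nrm p x k) ε
  have hε0 : 0 ≤ ε := by positivity
  have hsub : P.real {ω | ∀ j < k, A j ω ∈ {A : Mat d | A - q • M j ∈ coneMaps K}}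
      ≤ P.real {ω | ε ≤ nrm (trajectory (fun j => A j ω) x k) ^ p} := by
    refine ENNReal.toReal_mono (measure_ne_top _ _) (measure_mono_ae ?_)
    filter_upwards [hA.ae_mem_support] with ω hω hdom
    have h1 := trajectory_sub_smul_mem hK hq hx (fun j _ => hinv _ (hω j)) hM hdom
    have h2 := hcK _ _ (hK.smul_mem _ (pow_nonneg hq k) _ (trajectory_mem_cone hx hM)) h1
    rw [norm_smul, Real.norm_of_nonneg (pow_nonneg hq k)] at h2
    refine pow_le_pow_left₀ (by positivity) ?_ p
    rwa [div_le_iff₀' hc]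
  have h3 : ε * δ ^ k ≤ meanPow P nrm A p x k :=
    (mul_le_mul_of_nonneg_left (hprob.trans hsub) hε0).trans hmarkov
  have h4 : (q ^ k * ‖trajectory M x k‖) ^ p = c ^ p * ε := by
    rw [hε, ← mul_pow, mul_div_cancel₀ _ hc.ne']
  rw [h4]
  calc δ ^ k * (c ^ p * ε) = c ^ p * (ε * δ ^ k) := by ring
    _ ≤ _ := by gcongr

theorem wordProd_smul {ι E : Type*} [AddCommGroup E] [Module ℝ E] (c : ℝ)
    (T : ι → Module.End ℝ E) (w : List ι) (x : E) :
    wordProd (fun i => c • T i) w x = c ^ w.length • wordProd T w x := by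
  induction w with
  | nil => simp
  | cons i w ih =>
    rw [wordProd_cons, wordProd_cons, ih, LinearMap.smul_apply, map_smul, smul_smul,
      List.length_cons, pow_succ']

/-- The semigroup generated by finitely many dominated matrices does not grow faster than any
bound on all the mean growth rates. -/
theorem FollowIndependently.exists_norm_wordProd_le [IsProbabilityMeasure P]
    [IsProbabilityMeasure μ]
    (hA : FollowIndependently A μ P) (hcompact : IsCompact μ.support)
    {nrm : Seminorm ℝ (Fin d → ℝ)} (hnrm : ∀ x, nrm x = 0 → x = 0)
    {K : Set (Fin d → ℝ)} (hK : IsProperCone K) (hinv : LeavesInvariant μ.support K)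
    {g η : ℝ} (hg : 0 < g) (hgη : g < η)
    (hmean : ∀ p : ℕ, 1 ≤ p → ∀ x, ∃ C : ℝ, 0 < C ∧ ∀ k, meanPow P nrm A p x k ≤ (C * g ^ k) ^ p)
    (F : Finset (dominatedSupport μ K)) (x : Fin d → ℝ) :
    ∃ C : ℝ, ∀ w : List (dominatedSupport μ K), (∀ i ∈ w, i ∈ F) →
      ‖wordProd (fun M : dominatedSupport μ K => (M : Mat d).mulVecLin) w x‖
        ≤ C * η ^ w.length := by
  have hη : 0 < η := hg.trans hgη
  obtain ⟨e, he⟩ := hK.solid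
  -- Taking `q > g / η` leaves the ratio `g / (q * η)` below 1, which pays for `δ` below.
  obtain ⟨q, hq1, hq2⟩ := exists_between ((div_lt_one hη).2 hgη)
  have hq0 : 0 < q := (div_pos hg hη).trans hq1
  -- Finiteness of `F` is what makes the domination probability uniformly positive.
  obtain ⟨δ, hδ, hδF⟩ : ∃ δ : ℝ, 0 < δ ∧
      ∀ M ∈ F, δ ≤ μ.real {A | A - q • (M : Mat d) ∈ coneMaps K} := by
    rcases F.eq_empty_or_nonempty with rfl | hF
    · exact ⟨1, one_pos, by simp⟩
    · obtain ⟨M, hM, hmin⟩ := F.exists_min_image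
        (fun M => μ.real {A | A - q • (M : Mat d) ∈ coneMaps K}) hF
      exact ⟨_, ENNReal.toReal_pos (M.2.2 q hq0 hq2).ne' (measure_ne_top _ _), hmin⟩
  obtain ⟨c₁, hc₁, hc₁K⟩ := hK.exists_norm_le
  obtain ⟨c₂, hc₂, hc₂n⟩ := exists_seminorm_le_mul (normSeminorm ℝ (Fin d → ℝ)) nrm hnrm
  have hcK : ∀ a b, a ∈ K → b - a ∈ K → ‖a‖ ≤ c₁ * c₂ * nrm b := fun a b ha hab => by
    refine (hc₁K a b ha hab).trans ?_
    rw [mul_assoc]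
    exact mul_le_mul_of_nonneg_left (hc₂n b) hc₁.le
  have hr : g / (q * η) < 1 := by
    rw [div_lt_one (by positivity)]
    rwa [div_lt_iff₀ hη] at hq1
  -- The moment `p = n + 1` is chosen so large that $g\le\delta^{1/p}q\eta$. It depends on `F`
  -- through `δ`, so one rate must be available for all moments.
  obtain ⟨n, hn⟩ := exists_pow_lt_of_lt_one hδ hr
  have hgp : g ^ (n + 1) ≤ δ * (q * η) ^ (n + 1) := by
    have h1 : (g / (q * η)) ^ (n + 1) ≤ δ := by
      refine le_trans ?_ hn.le
      exact pow_le_pow_of_le_one (by positivity) hr.le (Nat.le_succ n)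
    rwa [div_pow, div_le_iff₀ (by positivity)] at h1
  obtain ⟨C, hC, hCe⟩ := hmean (n + 1) (by omega) e
  obtain ⟨C', hC', hCx⟩ := exists_norm_trajectory_le_interior hK he x
  refine ⟨C' * (c₁ * c₂ * C), fun w hw => ?_⟩
  obtain ⟨M, hMw, hMx⟩ := exists_trajectory_eq_wordProd (fun M : dominatedSupport μ K => (M : Mat d)) w
  set k := w.length
  have hMK : ∀ j < k, M j ∈ coneMaps K := fun j hj => by
    obtain ⟨i, _, h⟩ := hMw j hj
    rw [h]
    exact hinv _ i.2.1
  have hMδ : ∀ j < k, δ ≤ μ.real {A | A - q • M j ∈ coneMaps K} := fun j hj => by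
    obtain ⟨i, hi, h⟩ := hMw j hj
    rw [h]
    exact hδF i (hw i hi)
  have hlow := hA.pow_mul_pow_le_meanPow hcompact hK hinv (mul_pos hc₁ hc₂) hcK
    (interior_subset he) hq0.le hδ.le hMK hMδ (n + 1)
  have hpow : ‖trajectory M e k‖ ^ (n + 1) ≤ (c₁ * c₂ * C * η ^ k) ^ (n + 1) := by
    have h1 : δ ^ k * (q ^ k * ‖trajectory M e k‖) ^ (n + 1)
        ≤ δ ^ k * (q ^ k * (c₁ * c₂ * C * η ^ k)) ^ (n + 1) := by
      calc _ ≤ (c₁ * c₂) ^ (n + 1) * (C * g ^ k) ^ (n + 1) :=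
            hlow.trans (mul_le_mul_of_nonneg_left (hCe k) (by positivity))
        _ = (c₁ * c₂ * C) ^ (n + 1) * (g ^ (n + 1)) ^ k := by ring
        _ ≤ (c₁ * c₂ * C) ^ (n + 1) * (δ * (q * η) ^ (n + 1)) ^ k := by gcongr
        _ = _ := by ring
    have h2 := le_of_mul_le_mul_left h1 (by positivity)
    rw [mul_pow, mul_pow (q ^ k)] at h2
    exact le_of_mul_le_mul_left h2 (by positivity)
  have hle : ‖trajectory M e k‖ ≤ c₁ * c₂ * C * η ^ k :=
    le_of_pow_le_pow_left₀ (by omega) (by positivity) hpow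
  rw [← hMx x]
  refine (hCx M k hMK).trans ?_
  rw [mul_assoc C']
  exact mul_le_mul_of_nonneg_left hle hC'.le

theorem FollowIndependently.absolutelyAsymptoticallyStable [IsProbabilityMeasure P]
    [IsProbabilityMeasure μ]
    (hA : FollowIndependently A μ P) (hcompact : IsCompact μ.support)
    (hμ : ConeAndAtomicSingularPart μ)
    {nrm : Seminorm ℝ (Fin d → ℝ)} (hnrm : ∀ x, nrm x = 0 → x = 0)
    {γ : ℝ} (hγ0 : 0 ≤ γ) (hγ1 : γ < 1)
    (hmean : ∀ p : ℕ, 1 ≤ p → ∀ x₀ : Fin d → ℝ,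
      (fun k : ℕ => meanPow P nrm A p x₀ k ^ (1 / (p : ℝ))) =O[atTop] (fun k : ℕ => γ ^ k)) :
    AbsolutelyAsymptoticallyStable μ.support := by
  obtain ⟨K, hK, hinv⟩ := hμ.invariant_cone
  obtain ⟨g, hγg, hg1⟩ := exists_between hγ1
  obtain ⟨η, hgη, hη1⟩ := exists_between hg1
  -- Unlike `γ`, the rate `g` is nonzero, so the asymptotic bound can be turned into one valid for
  -- every `k`.
  have hg0 : 0 < g := hγ0.trans_lt hγg
  have hη0 : 0 < η := hg0.trans hgη
  have hbound : ∀ p : ℕ, 1 ≤ p → ∀ x, ∃ C : ℝ, 0 < C ∧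
      ∀ k, meanPow P nrm A p x k ≤ (C * g ^ k) ^ p := by
    intro p hp x
    have hγgO : (fun k : ℕ => γ ^ k) =O[atTop] (fun k : ℕ => g ^ k) :=
      isBigO_of_le _ fun k => by
        rw [norm_pow, norm_pow, Real.norm_of_nonneg hγ0, Real.norm_of_nonneg hg0.le]
        exact pow_le_pow_left₀ hγ0 hγg.le k
    obtain ⟨C, hC, hCk⟩ := bound_of_isBigO_nat_atTop ((hmean p hp x).trans hγgO)
    refine ⟨C, hC, fun k => ?_⟩
    have h := hCk (x := k) (by positivity)
    have h0 := meanPow_nonneg (P := P) (A := A) nrm p x k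
    rw [Real.norm_of_nonneg (by positivity), Real.norm_of_nonneg (by positivity)] at h
    calc meanPow P nrm A p x k = (meanPow P nrm A p x k ^ (1 / (p : ℝ))) ^ p := by
          rw [one_div, Real.rpow_inv_natCast_pow h0 (by omega)]
      _ ≤ _ := pow_le_pow_left₀ (by positivity) h p
  obtain ⟨B, _, hB⟩ := exists_norm_mulVec_le hcompact
  -- After division by `η` finite subfamilies have bounded orbits. The slack `(1 - η) / 2` is small
  -- enough that `η * (1 + (1 - η) / 2) < 1`.
  obtain ⟨N, hN, hNT⟩ := exists_norm_apply_le _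
    (fun M : dominatedSupport μ K => η⁻¹ • (M : Mat d).mulVecLin) (η⁻¹ * B)
    (fun M x => by
      rw [LinearMap.smul_apply, norm_smul, Real.norm_of_nonneg (by positivity), mul_assoc]
      exact mul_le_mul_of_nonneg_left (hB _ M.2.1 x) (by positivity))
    (fun F x => by
      obtain ⟨C, hC⟩ := hA.exists_norm_wordProd_le hcompact hnrm hK hinv hg0 hgη hbound F x
      refine ⟨C, fun w hw => ?_⟩
      rw [wordProd_smul, norm_smul, Real.norm_of_nonneg (by positivity), inv_pow,
        inv_mul_le_iff₀ (by positivity), mul_comm]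
      exact hC w hw)
    rfl ((1 - η) / 2) (by linarith)
  refine absolutelyAsymptoticallyStable_of_seminorm
    (support_subset_closure_dominatedSupport μ hK hinv hμ.singular_atomic) N hN
    (θ := η * (1 + (1 - η) / 2)) (mul_nonneg hη0.le (by linarith)) (by nlinarith)
    fun M hM x => ?_
  have h := hNT ⟨M, hM⟩ x
  rw [LinearMap.smul_apply, map_smul_eq_mul, Real.norm_of_nonneg (by positivity),
    inv_mul_le_iff₀ hη0, ← mul_assoc] at h
  exact h

theorem FollowIndependently.exists_meanStableWithRate [IsProbabilityMeasure P]
    (hA : FollowIndependently A μ P) (hcompact : IsCompact μ.support)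
    {nrm : Seminorm ℝ (Fin d → ℝ)} (hnrm : ∀ x, nrm x = 0 → x = 0)
    (h : AbsolutelyAsymptoticallyStable μ.support) :
    ∃ γ : ℝ, 0 ≤ γ ∧ γ < 1 ∧ ∀ p : ℕ, 1 ≤ p → MeanStableWithRate P nrm A p γ := by
  obtain ⟨C, θ, hC, hθ0, hθ1, hbound⟩ := h.exists_exponential_bound hcompact
  obtain ⟨c₁, hc₁, hc₁n⟩ := exists_seminorm_le_mul_norm nrm
  obtain ⟨c₂, hc₂, hc₂n⟩ := exists_seminorm_le_mul (normSeminorm ℝ (Fin d → ℝ)) nrm hnrm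
  refine ⟨θ, hθ0.le, hθ1, fun p hp => ?_⟩
  have hp0 : (0 : ℝ) < p := by exact_mod_cast hp
  have hlog : Real.log θ < 0 := Real.log_neg hθ0 hθ1
  -- The choice $\beta=-p\log\theta$ makes $e^{-\beta/p}$ equal to $\theta$ for every `p`.
  refine ⟨(c₁ * C * c₂) ^ p, p * -Real.log θ, by positivity, mul_pos hp0 (neg_pos.2 hlog), ?_, ?_⟩
  · rw [← Real.exp_mul]
    have : -(↑p * -Real.log θ) * (1 / (p : ℝ)) = Real.log θ := by field_simp
    rw [this, Real.exp_log hθ0]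
  · intro x k
    have hexp : Real.exp (-(p * -Real.log θ) * k) = (θ ^ k) ^ p := by
      have : -(p * -Real.log θ) * (k : ℝ) = ((k * p : ℕ) : ℝ) * Real.log θ := by
        push_cast; ring
      rw [this, Real.exp_nat_mul, Real.exp_log hθ0, pow_mul]
    rw [hexp, ← mul_pow, ← mul_pow]
    have hae : ∀ᵐ ω ∂P, nrm (trajectory (fun j => A j ω) x k) ^ p
        ≤ (c₁ * C * c₂ * θ ^ k * nrm x) ^ p := by
      filter_upwards [hA.ae_mem_support] with ω hω
      refine pow_le_pow_left₀ (apply_nonneg nrm _) ?_ p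
      calc nrm (trajectory (fun j => A j ω) x k)
          ≤ c₁ * (C * θ ^ k * ‖x‖) := (hc₁n _).trans (by gcongr; exact hbound _ hω x k)
        _ ≤ c₁ * (C * θ ^ k * (c₂ * nrm x)) := by gcongr; exact hc₂n x
        _ = _ := by ring
    calc meanPow P nrm A p x k ≤ ∫ _, (c₁ * C * c₂ * θ ^ k * nrm x) ^ p ∂P :=
          integral_mono_ae (hA.integrable_pow hcompact nrm p x k) (integrable_const _) hae
      _ = _ := by simp

theorem MeanStableWithRate.isBigO {nrm : Seminorm ℝ (Fin d → ℝ)} {p : ℕ} (hp : 1 ≤ p) {γ : ℝ}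
    (hγ : 0 ≤ γ) (h : MeanStableWithRate P nrm A p γ) (x : Fin d → ℝ) :
    (fun k : ℕ => meanPow P nrm A p x k ^ (1 / (p : ℝ))) =O[atTop] (fun k : ℕ => γ ^ k) := by
  obtain ⟨M, β, hM, _, hγβ, hbound⟩ := h
  refine IsBigO.of_bound (M ^ (1 / (p : ℝ)) * nrm x) (Eventually.of_forall fun k => ?_)
  have h0 := meanPow_nonneg (P := P) (A := A) nrm p x k
  have hx := apply_nonneg nrm x
  rw [Real.norm_of_nonneg (by positivity), Real.norm_of_nonneg (by positivity)]
  calc meanPow P nrm A p x k ^ (1 / (p : ℝ))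
      ≤ (M * Real.exp (-β * k) * nrm x ^ p) ^ (1 / (p : ℝ)) := by
        gcongr; exact hbound x k
    _ = M ^ (1 / (p : ℝ)) * (Real.exp (-β) ^ (1 / (p : ℝ))) ^ k * nrm x := by
        rw [Real.mul_rpow (by positivity) (by positivity), Real.mul_rpow hM.le (by positivity),
          one_div, Real.pow_rpow_inv_natCast hx (by omega), ← Real.exp_mul, ← Real.exp_mul,
          ← Real.exp_nat_mul]
        ring_nf
    _ ≤ M ^ (1 / (p : ℝ)) * γ ^ k * nrm x := by gcongr
    _ = _ := by ring

end Probability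

end SwitchedSystem

/-! ### The equivalence -/

theorem mainTheorem4 {d : ℕ} (μ : Measure (SwitchedSystem.Mat d)) [IsProbabilityMeasure μ]
    (hcompact : IsCompact μ.support)
    (hμ : SwitchedSystem.ConeAndAtomicSingularPart μ)
    (nrm : Seminorm ℝ (Fin d → ℝ)) (hnrm : ∀ x, nrm x = 0 → x = 0)
    {Ω : Type*} [MeasurableSpace Ω] (P : Measure Ω) [IsProbabilityMeasure P]
    (A : ℕ → Ω → SwitchedSystem.Mat d)
    (hA : SwitchedSystem.FollowIndependently A μ P) :
    (SwitchedSystem.AbsolutelyAsymptoticallyStable μ.support ↔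
      ∃ γ : ℝ, 0 ≤ γ ∧ γ < 1 ∧ ∀ p : ℕ, 1 ≤ p →
        SwitchedSystem.MeanStableWithRate P nrm A p γ) ∧
    (SwitchedSystem.AbsolutelyAsymptoticallyStable μ.support ↔
      ∃ γ : ℝ, 0 ≤ γ ∧ γ < 1 ∧ ∀ p : ℕ, 1 ≤ p → ∀ x₀ : Fin d → ℝ,
        (fun k : ℕ => SwitchedSystem.meanPow P nrm A p x₀ k ^ (1 / (p : ℝ)))
          =O[atTop] (fun k : ℕ => γ ^ k)) := by
  have h12 := hA.exists_meanStableWithRate hcompact hnrm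
  refine ⟨⟨h12, ?_⟩, fun h => ?_, ?_⟩
  · rintro ⟨γ, hγ0, hγ1, h⟩
    exact hA.absolutelyAsymptoticallyStable hcompact hμ hnrm hγ0 hγ1
      fun p hp => (h p hp).isBigO hp hγ0
  · obtain ⟨γ, hγ0, hγ1, hγ⟩ := h12 h
    exact ⟨γ, hγ0, hγ1, fun p hp => (hγ p hp).isBigO hp hγ0⟩
  · rintro ⟨γ, hγ0, hγ1, h⟩
    exact hA.absolutelyAsymptoticallyStable hcompact hμ hnrm hγ0 hγ1 h
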